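/- All graphs are finite and simple. Let $\mathrm{tw}(G)$, $\omega(G)$ and $\alpha(G)$ denote the treewidth, the clique number and the independence number of a graph $G$. A function $f$ from $\mathbb{N}$ to the real numbers is a \emph{$(\mathrm{tw},\omega)$-binding function} for a graph class $\mathcal{G}$ if $\mathrm{tw}(G')\le f(\omega(G'))$ for every $G\in\mathcal{G}$ and every induced subgraph $G'$ of $G$. A class is \emph{$(\mathrm{tw},\omega)$-bounded} if it has a $(\mathrm{tw},\omega)$-binding function $\mathbb{N}\to\mathbb{N}$, and \emph{polynomially $(\mathrm{tw},\omega)$-bounded} if it has such a function $\mathbb{N}\to\mathbb{N}$ that is given by a polynomial. \textbf{Theorem.} For every integer $q\ge 3$, let $\mathcal{G}_q$ denote the class of graphs $G$ with $\alpha(G)<q$. Then $\mathcal{G}_q$ is $(\mathrm{tw},\omega)$-bounded, and \begin{itemize} \item $\mathcal{G}_q$ has a $(\mathrm{tw},\omega)$-binding function $\mathbb{N}\to\mathbb{N}$ that is given by a polynomial of degree $q-1$; \item for every real $c>0$ and every real $\epsilon>0$, the function $f(k)=c\,k^{(q+1)/2-\epsilon}$ is not a $(\mathrm{tw},\omega)$-binding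 function for $\mathcal{G}_q$. \end{itemize} Consequently, there exists no polynomial that is a $(\mathrm{tw},\omega)$-binding function for all polynomially $(\mathrm{tw},\omega)$-bounded graph classes. -/

import Mathlib

open scoped Polynomial

/-- A tree decomposition of a graph `G`, with a tree on the (finite) node set `ι`. -/
structure TreeDecomposition {V : Type*} (G : SimpleGraph V) (ι : Type*) where
  /-- the underlying tree -/
  tree : SimpleGraph ι
  isTree : tree.IsTree
  /-- the vertex subset associated with each node -/
  bag : ι → Finset V
  /-- the bags cover the vertex set -/
  vertex_covered : ∀ v : V, ∃ t, v ∈ bag t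
  /-- every edge is contained in some bag -/
  edge_covered : ∀ u v : V, G.Adj u v → ∃ t, u ∈ bag t ∧ v ∈ bag t
  /-- the nodes whose bags contain a given vertex induce a connected subtree -/
  connected : ∀ v : V, (tree.induce {t | v ∈ bag t}).Connected

/-- The width of a tree decomposition: the maximum size of a bag, minus one. The truncated
subtraction matters only if all the bags are empty, that is, if the graph has no vertices. -/
def TreeDecomposition.width {V : Type*} {G : SimpleGraph V} {ι : Type*} [Fintype ι]
    (D : TreeDecomposition G ι) : ℕ :=
  (Finset.univ.sup fun t => (D.bag t).card) - 1

/-- The treewidth of a (finite) graph: the minimum width of a tree decomposition.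
Up to relabelling, the nodes of a finite tree are the elements of `Fin n`. -/
noncomputable def treewidth {V : Type*} (G : SimpleGraph V) : ℕ :=
  sInf {w | ∃ (n : ℕ) (D : TreeDecomposition G (Fin n)), D.width = w}

/-- A class of finite simple graphs, closed under isomorphism. -/
structure GraphClass where
  Mem : ∀ {V : Type} [Finite V], SimpleGraph V → Prop
  mem_of_iso : ∀ {V W : Type} [Finite V] [Finite W] {G : SimpleGraph V} {H : SimpleGraph W},
    Nonempty (G ≃g H) → Mem G → Mem H

/-- `f` is a (tw, ω)-binding function for `𝒢`: every induced subgraph `G'` of every graph in `𝒢`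
satisfies `tw(G') ≤ f(ω(G'))`. The values of `f` may be real, so that the notion also applies to
functions such as `k ↦ c k ^ s` with real `c` and `s`. -/
def GraphClass.IsTwOmegaBinding (𝒢 : GraphClass) (f : ℕ → ℝ) : Prop :=
  ∀ (V : Type) [Finite V] (G : SimpleGraph V), 𝒢.Mem G →
    ∀ s : Set V, (treewidth (G.induce s) : ℝ) ≤ f (G.induce s).cliqueNum

/-- `𝒢` is (tw, ω)-bounded: it has a (tw, ω)-binding function `ℕ → ℕ`. -/
def GraphClass.IsTwOmegaBounded (𝒢 : GraphClass) : Prop :=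
  ∃ f : ℕ → ℕ, 𝒢.IsTwOmegaBinding fun k => (f k : ℝ)

/-- `𝒢` is polynomially (tw, ω)-bounded: it has a (tw, ω)-binding function `ℕ → ℕ` that is given
by a polynomial. -/
def GraphClass.IsPolynomiallyTwOmegaBounded (𝒢 : GraphClass) : Prop :=
  ∃ (f : ℕ → ℕ) (p : ℝ[X]), (∀ k : ℕ, (f k : ℝ) = p.eval (k : ℝ)) ∧
    𝒢.IsTwOmegaBinding fun k => (f k : ℝ)

/-- An isomorphism does not decrease the independence number. -/
theorem indepNum_le_of_iso {V W : Type} [Finite V] [Finite W] {G : SimpleGraph V}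
    {H : SimpleGraph W} (e : G ≃g H) : H.indepNum ≤ G.indepNum := by
  obtain ⟨s, hs⟩ := H.exists_isNIndepSet_indepNum
  have h : G.IsIndepSet (s.map e.symm.toEquiv.toEmbedding : Finset V) := by
    intro a ha b hb hab hadj
    simp only [Finset.coe_map, Set.mem_image] at ha hb
    obtain ⟨x, hx, rfl⟩ := ha
    obtain ⟨y, hy, rfl⟩ := hb
    refine hs.isIndepSet hx hy (fun hxy => hab (by rw [hxy])) ?_
    exact e.symm.map_adj_iff.1 hadj
  have h' := h.card_le_indepNum
  rwa [Finset.card_map, hs.card_eq] at h'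

/-- The class of graphs with independence number less than `q`. -/
def boundedIndepClass (q : ℕ) : GraphClass where
  Mem G := G.indepNum < q
  mem_of_iso := fun ⟨e⟩ h => (indepNum_le_of_iso e).trans_lt h

/-! When `α(G) < q`, treewidth is governed by the number of vertices. Trivially `tw(G) ≤ |V| - 1`,
while every graph satisfies `|V| ≤ α(G) (tw(G) + 1)` (`card_le_indepNum_mul_treewidth_add_one`). The
best binding function is thus, up to constants depending on `q`, an off-diagonal Ramsey number.

The Erdős–Szekeres bound gives the polynomial of degree `q - 1`. For the lower bound, the deletion
method yields, for large `k`, graphs without `q`-cliques or independent `k`-sets on about `k ^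
((q+1)/2 - η)` vertices (`eventually_exists_cliqueFree_indepSetFree`); their complements lie in the
class and have clique number at most `k`. As the exponent grows with `q`, no single polynomial
serves all `q`. -/

/-! ### Treewidth and the independence number -/

/-- In a tree, a path from `r` to a vertex `x` of a connected set `S` may be taken to go first to
a vertex `t` of `S` nearest to `r`, and then to stay in `S`. -/
theorem exists_isPath_append_of_nearest {ι : Type*} {T : SimpleGraph ι} (hT : T.IsTree)
    {S : Set ι} (hS : (T.induce S).Connected) {r t x : ι} (ht : t ∈ S) (hx : x ∈ S)
    (hmin : ∀ y ∈ S, T.dist r t ≤ T.dist r y) :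
    ∃ (a : T.Walk r t) (b : T.Walk t x), (a.append b).IsPath ∧ a.length = T.dist r t ∧
      ∀ y ∈ b.support, y ∈ S := by
  classical
  obtain ⟨a, ha, hal⟩ := hT.connected.exists_path_of_dist r t
  obtain ⟨b', hb'⟩ := (hS ⟨t, ht⟩ ⟨x, hx⟩).exists_isPath
  let b : T.Walk t x := b'.map (SimpleGraph.Embedding.induce S).toHom
  have hb : b.IsPath := hb'.map (SimpleGraph.Embedding.induce (G := T) S).injective
  have hbS : ∀ y ∈ b.support, y ∈ S := by
    intro y hy
    rw [show b.support = b'.support.map Subtype.val from SimpleGraph.Walk.support_map _ _,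
      List.mem_map] at hy
    obtain ⟨z, -, rfl⟩ := hy
    exact z.2
  refine ⟨a, b, ?_, hal, hbS⟩
  rw [SimpleGraph.Walk.isPath_def, SimpleGraph.Walk.support_append, List.nodup_append]
  have hbn := (SimpleGraph.Walk.isPath_def _).1 hb
  rw [← SimpleGraph.Walk.cons_tail_support] at hbn
  refine ⟨(SimpleGraph.Walk.isPath_def _).1 ha, hbn.of_cons, ?_⟩
  rintro y hya z hyb rfl
  have hyS := hbS y (List.mem_of_mem_tail hyb)
  have h1 := hmin y hyS
  -- A vertex of the shortest path `a` that lies in `S` is at distance at least `T.dist r t =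
  -- a.length` from `r`, so it is `t` itself, which does not recur in the path `b`.
  have h2 : (a.takeUntil y hya).length + (a.dropUntil y hya).length = a.length := by
    rw [← SimpleGraph.Walk.length_append, SimpleGraph.Walk.take_spec]
  have h3 := SimpleGraph.dist_le (a.takeUntil y hya)
  have h4 : (a.dropUntil y hya).length = 0 := by omega
  have h5 := SimpleGraph.Walk.eq_of_length_eq_zero h4
  subst h5
  exact (List.nodup_cons.1 hbn).1 hyb

/-- If two connected sets of vertices of a tree meet, then the one whose distance from `r` is
smaller contains the vertex of the other one nearest to `r`. -/
theorem mem_of_nearest_of_inter {ι : Type*} {T : SimpleGraph ι} (hT : T.IsTree)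
    {S S' : Set ι} (hS : (T.induce S).Connected) (hS' : (T.induce S').Connected)
    {r t t' x : ι} (ht : t ∈ S) (ht' : t' ∈ S')
    (hmin : ∀ y ∈ S, T.dist r t ≤ T.dist r y) (hmin' : ∀ y ∈ S', T.dist r t' ≤ T.dist r y)
    (hle : T.dist r t' ≤ T.dist r t) (hx : x ∈ S) (hx' : x ∈ S') : t ∈ S' := by
  obtain ⟨a, b, hab, hal, -⟩ := exists_isPath_append_of_nearest hT hS ht hx hmin
  obtain ⟨a', b', hab', hal', hb'⟩ := exists_isPath_append_of_nearest hT hS' ht' hx' hmin'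
  have h := (hT.existsUnique_path r x).unique hab hab'
  -- Both paths from `r` to `x` coincide. Position `a.length ≥ a'.length` holds `t`, and on the
  -- second path it falls in the part inside `S'`.
  have h1 : (a.append b).getVert a.length = t := by
    simp [SimpleGraph.Walk.getVert_append]
  rw [h, SimpleGraph.Walk.getVert_append, if_neg (by omega)] at h1
  rw [← h1]
  exact hb' _ (SimpleGraph.Walk.getVert_mem_support _ _)

namespace TreeDecomposition

variable {V ι : Type*} {G : SimpleGraph V}

/-- Among the vertices of a nonempty set `W` there is one, `v`, with a node `t` of its subtree that
belongs to the subtree of every vertex of `W` whose subtree meets that of `v`. -/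
theorem exists_simplicial (D : TreeDecomposition G ι) {W : Finset V} (hW : W.Nonempty) :
    ∃ v ∈ W, ∃ t, v ∈ D.bag t ∧ ∀ u ∈ W, ∀ x, v ∈ D.bag x → u ∈ D.bag x → u ∈ D.bag t := by
  classical
  obtain ⟨r⟩ := D.isTree.connected.nonempty
  have htop : ∀ v, ∃ t, v ∈ D.bag t ∧ ∀ y, v ∈ D.bag y → D.tree.dist r t ≤ D.tree.dist r y := by
    intro v
    obtain ⟨t, ht, hmin⟩ := exists_minimalFor_of_wellFoundedLT (fun t => v ∈ D.bag t)
      (D.tree.dist r) (D.vertex_covered v)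
    refine ⟨t, ht, fun y hy => ?_⟩
    rcases le_total (D.tree.dist r t) (D.tree.dist r y) with h | h
    · exact h
    · exact hmin hy h
  choose top htop htop' using htop
  obtain ⟨v, hv, hmax⟩ := W.exists_max_image (fun v => D.tree.dist r (top v)) hW
  refine ⟨v, hv, top v, htop v, fun u hu x hvx hux => ?_⟩
  exact mem_of_nearest_of_inter D.isTree (D.connected v) (D.connected u) (htop v) (htop u)
    (htop' v) (htop' u) (hmax u hu) hvx hux

/-- Greedy choice: the bag at `t` contains `v` and all its neighbours in `W`, so deleting it costs
at most `b` vertices and leaves only non-neighbours of `v`. -/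
theorem exists_isIndepSet_card_le (D : TreeDecomposition G ι) {b : ℕ}
    (hb : ∀ t, (D.bag t).card ≤ b) (W : Finset V) :
    ∃ I ⊆ W, G.IsIndepSet (I : Set V) ∧ W.card ≤ I.card * b := by
  classical
  induction W using Finset.strongInduction with
  | H W ih =>
    rcases W.eq_empty_or_nonempty with rfl | hW
    · exact ⟨∅, by simp⟩
    obtain ⟨v, hv, t, hvt, ht⟩ := D.exists_simplicial hW
    have hss : W \ D.bag t ⊂ W := Finset.ssubset_iff_subset_ne.2
      ⟨Finset.sdiff_subset, fun h => (Finset.mem_sdiff.1 (h.symm ▸ hv)).2 hvt⟩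
    obtain ⟨I, hIW, hI, hcard⟩ := ih _ hss
    have hvI : v ∉ I := fun h => (Finset.mem_sdiff.1 (hIW h)).2 hvt
    have hadj : ∀ u ∈ I, ¬ G.Adj v u := by
      intro u hu huv
      obtain ⟨x, hx1, hx2⟩ := D.edge_covered _ _ huv
      have := Finset.mem_sdiff.1 (hIW hu)
      exact this.2 (ht u this.1 x hx1 hx2)
    refine ⟨insert v I, ?_, ?_, ?_⟩
    · exact Finset.insert_subset hv (hIW.trans Finset.sdiff_subset)
    · rw [Finset.coe_insert]
      refine hI.insert fun u hu _ => ⟨hadj u hu, fun h => hadj u hu h.symm⟩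
    · rw [Finset.card_insert_of_notMem hvI, add_mul, one_mul]
      have := Finset.le_card_sdiff (D.bag t) W
      have := hb t
      omega

/-- The decomposition with a single bag. -/
def single [Fintype V] (G : SimpleGraph V) : TreeDecomposition G (Fin 1) where
  tree := ⊥
  isTree := SimpleGraph.IsTree.of_subsingleton
  bag _ := Finset.univ
  vertex_covered v := ⟨0, Finset.mem_univ v⟩
  edge_covered u v _ := ⟨0, Finset.mem_univ u, Finset.mem_univ v⟩
  connected v := by
    have : Nonempty {t : Fin 1 | v ∈ (Finset.univ : Finset V)} := ⟨⟨0, Finset.mem_univ v⟩⟩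
    exact (SimpleGraph.IsTree.of_subsingleton).connected

end TreeDecomposition

theorem treewidth_le_card_sub_one {V : Type*} [Fintype V] (G : SimpleGraph V) :
    treewidth G ≤ Fintype.card V - 1 := by
  refine Nat.sInf_le ⟨1, TreeDecomposition.single G, ?_⟩
  simp [TreeDecomposition.width, TreeDecomposition.single]

theorem card_le_indepNum_mul_treewidth_add_one {V : Type*} [Fintype V] (G : SimpleGraph V) :
    Fintype.card V ≤ G.indepNum * (treewidth G + 1) := by
  obtain ⟨n, D, hD⟩ := Nat.sInf_mem (s := {w | ∃ (n : ℕ) (D : TreeDecomposition G (Fin n)),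
    D.width = w}) ⟨_, 1, TreeDecomposition.single G, rfl⟩
  have hb : ∀ t, (D.bag t).card ≤ treewidth G + 1 := by
    intro t
    have h1 := Finset.le_sup (f := fun t => (D.bag t).card) (Finset.mem_univ t)
    change D.width = treewidth G at hD
    rw [← hD, TreeDecomposition.width]
    beta_reduce at h1
    omega
  obtain ⟨I, -, hI, hcard⟩ := D.exists_isIndepSet_card_le hb Finset.univ
  exact hcard.trans (Nat.mul_le_mul_right _ hI.card_le_indepNum)

/-! ### The upper bound -/

/-- The Erdős–Szekeres bound for Ramsey numbers. -/
theorem exists_isNClique_or_isNIndepSet {V : Type*} (G : SimpleGraph V) (a b : ℕ) (W : Finset V)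
    (hW : (a + b).choose a ≤ W.card) :
    (∃ s ⊆ W, G.IsNClique (a + 1) s) ∨ ∃ s ⊆ W, G.IsNIndepSet (b + 1) s := by
  classical
  induction h : a + b generalizing a b W with
  | zero =>
    obtain ⟨rfl, rfl⟩ : a = 0 ∧ b = 0 := by omega
    obtain ⟨v, hv⟩ := Finset.card_pos.1 (by simpa using hW)
    exact Or.inl ⟨{v}, by simpa using hv, by simp [SimpleGraph.isNClique_iff]⟩
  | succ m ih =>
    have hpos : 0 < W.card := (Nat.choose_pos (Nat.le_add_right a b)).trans_le hW
    obtain ⟨v, hv⟩ := Finset.card_pos.1 hpos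
    rcases a with _ | a
    · exact Or.inl ⟨{v}, by simpa using hv, by simp [SimpleGraph.isNClique_iff]⟩
    rcases b with _ | b
    · exact Or.inr ⟨{v}, by simpa using hv, by simp [SimpleGraph.isNIndepSet_iff]⟩
    set A := (W.erase v).filter (fun u => G.Adj v u) with hA
    set B := (W.erase v).filter (fun u => ¬ G.Adj v u) with hB
    have hAB : A.card + B.card + 1 = W.card := by
      rw [hA, hB, Finset.card_filter_add_card_filter_not, Finset.card_erase_add_one hv]
    have hch : (a + 1 + (b + 1)).choose (a + 1)
        = (a + (b + 1)).choose a + (a + 1 + b).choose (a + 1) := by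
      rw [show a + 1 + (b + 1) = (a + (b + 1)) + 1 by ring, Nat.choose_succ_succ,
        show a + 1 + b = a + (b + 1) by ring]
    have hAW : ∀ u ∈ A, u ∈ W ∧ u ≠ v ∧ G.Adj v u := fun u hu => by
      simp only [hA, Finset.mem_filter, Finset.mem_erase] at hu
      exact ⟨hu.1.2, hu.1.1, hu.2⟩
    have hBW : ∀ u ∈ B, u ∈ W ∧ u ≠ v ∧ ¬ G.Adj v u := fun u hu => by
      simp only [hB, Finset.mem_filter, Finset.mem_erase] at hu
      exact ⟨hu.1.2, hu.1.1, hu.2⟩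
    -- Pascal's rule: if both failed, `A` and `B` would have at least two elements fewer than the
    -- binomial coefficient in total, but only `v` is missing.
    have : (a + (b + 1)).choose a ≤ A.card ∨ (a + 1 + b).choose (a + 1) ≤ B.card := by omega
    rcases this with h1 | h1
    · rcases ih a (b + 1) A h1 (by omega) with ⟨s, hs, hc⟩ | ⟨s, hs, hc⟩
      · refine Or.inl ⟨insert v s, ?_, hc.insert fun u hu => (hAW u (hs hu)).2.2⟩
        exact Finset.insert_subset hv fun u hu => (hAW u (hs hu)).1
      · exact Or.inr ⟨s, fun u hu => (hAW u (hs hu)).1, hc⟩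
    · rcases ih (a + 1) b B h1 (by omega) with ⟨s, hs, hc⟩ | ⟨s, hs, hc⟩
      · exact Or.inl ⟨s, fun u hu => (hBW u (hs hu)).1, hc⟩
      · refine Or.inr ⟨insert v s, ?_, ?_⟩
        · exact Finset.insert_subset hv fun u hu => (hBW u (hs hu)).1
        · rw [← SimpleGraph.isNClique_compl] at hc ⊢
          refine hc.insert fun u hu => ?_
          rw [SimpleGraph.compl_adj]
          exact ⟨(hBW u (hs hu)).2.1.symm, (hBW u (hs hu)).2.2⟩

theorem card_lt_choose_cliqueNum_indepNum {V : Type*} [Fintype V] (G : SimpleGraph V) {q : ℕ}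
    (hq : G.indepNum < q + 1) : Fintype.card V < (G.cliqueNum + q).choose q := by
  by_contra! h
  rw [← Nat.choose_symm_add] at h
  rcases exists_isNClique_or_isNIndepSet G G.cliqueNum q Finset.univ h with
    ⟨s, -, hs⟩ | ⟨s, -, hs⟩
  · have := hs.isClique.card_le_cliqueNum
    rw [hs.card_eq] at this
    omega
  · have := hs.isIndepSet.card_le_indepNum
    rw [hs.card_eq] at this
    omega

theorem indepNum_induce_le {V : Type*} [Finite V] (G : SimpleGraph V) (s : Set V) :
    (G.induce s).indepNum ≤ G.indepNum := by
  obtain ⟨t, ht⟩ := (G.induce s).exists_isNIndepSet_indepNum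
  have h : G.IsIndepSet (t.map (Function.Embedding.subtype (· ∈ s)) : Finset V) := by
    intro a ha b hb hab hadj
    simp only [Finset.coe_map, Set.mem_image] at ha hb
    obtain ⟨x, hx, rfl⟩ := ha
    obtain ⟨y, hy, rfl⟩ := hb
    exact ht.isIndepSet hx hy (fun hxy => hab (by rw [hxy])) hadj
  have h' := h.card_le_indepNum
  rwa [Finset.card_map, ht.card_eq] at h'

/-- The polynomial `(X + 1) ⋯ (X + d) / d!`, whose value at `k` is the binomial coefficient
`(k + d).choose d`. -/
noncomputable def choosePolynomial (d : ℕ) : ℝ[X] :=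
  Polynomial.C ((d.factorial : ℝ)⁻¹) * (ascPochhammer ℝ d).comp (Polynomial.X + 1)

theorem natDegree_choosePolynomial (d : ℕ) : (choosePolynomial d).natDegree = d := by
  have h : (d.factorial : ℝ)⁻¹ ≠ 0 := inv_ne_zero (by exact_mod_cast d.factorial_ne_zero)
  rw [choosePolynomial, Polynomial.natDegree_C_mul h, Polynomial.natDegree_comp,
    ascPochhammer_natDegree, ← Polynomial.C_1, Polynomial.natDegree_X_add_C, mul_one]

theorem eval_choosePolynomial (d k : ℕ) :
    (choosePolynomial d).eval (k : ℝ) = ((k + d).choose d : ℕ) := by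
  have h : (d.factorial : ℝ) ≠ 0 := by exact_mod_cast d.factorial_ne_zero
  have h1 : (ascPochhammer ℝ d).eval ((k + 1 : ℕ) : ℝ) = ((k + 1).ascFactorial d : ℕ) := by
    rw [← ascPochhammer_nat_eq_ascFactorial, ascPochhammer_eval_cast]
  rw [choosePolynomial, Polynomial.eval_C_mul, Polynomial.eval_comp]
  simp only [Polynomial.eval_add, Polynomial.eval_X, Polynomial.eval_one]
  rw [← Nat.cast_succ, Nat.succ_eq_add_one, h1, Nat.ascFactorial_eq_factorial_mul_choose]
  push_cast
  field_simp

theorem isTwOmegaBinding_choose {q : ℕ} (hq : 1 ≤ q) :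
    (boundedIndepClass q).IsTwOmegaBinding fun k => ((k + (q - 1)).choose (q - 1) : ℕ) := by
  intro V _ G hG s
  have := Fintype.ofFinite s
  have h1 : (G.induce s).indepNum < q - 1 + 1 := by
    rw [Nat.sub_add_cancel hq]
    exact (indepNum_induce_le G s).trans_lt hG
  have h2 := card_lt_choose_cliqueNum_indepNum _ h1
  have h3 := treewidth_le_card_sub_one (G.induce s)
  exact Nat.cast_le.2 (h3.trans (Nat.sub_le_of_le_add (h2.le.trans (Nat.le_succ _))))

/-! ### Random subsets of a finite set -/

/-- The left side is the probability that a random subset of `U` with density `p` contains `A` and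
misses `B`. Expanding `∏ (f + g)`, with `f` zero on `B` and `g` zero on `A`, gives the right side.
-/
theorem sum_filter_weight_le {α : Type*} [DecidableEq α] {U A B : Finset α} (hA : A ⊆ U)
    (hB : B ⊆ U) (hAB : Disjoint A B) {p : ℝ} (hp0 : 0 ≤ p) (hp1 : p ≤ 1) :
    ∑ E ∈ U.powerset with A ⊆ E ∧ Disjoint E B, p ^ E.card * (1 - p) ^ (U \ E).card
      ≤ p ^ A.card * (1 - p) ^ B.card := by
  have hp1' : 0 ≤ 1 - p := sub_nonneg.2 hp1
  set f : α → ℝ := fun e => if e ∈ B then 0 else p with hf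
  set g : α → ℝ := fun e => if e ∈ A then 0 else 1 - p with hg
  have hf0 : ∀ e, 0 ≤ f e := fun e => by simp only [hf]; split_ifs <;> simp [hp0]
  have hg0 : ∀ e, 0 ≤ g e := fun e => by simp only [hg]; split_ifs <;> simp [hp1]
  have hfg : ∏ e ∈ U, (f e + g e) = p ^ A.card * (1 - p) ^ B.card := by
    have : ∀ e ∈ U, f e + g e = (if e ∈ A then p else 1) * (if e ∈ B then 1 - p else 1) := by
      intro e _
      by_cases h1 : e ∈ A
      · simp [hf, hg, h1, Finset.disjoint_left.1 hAB h1]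
      · by_cases h2 : e ∈ B <;> simp [hf, hg, h1, h2]
    rw [Finset.prod_congr rfl this, Finset.prod_mul_distrib, Finset.prod_ite_mem,
      Finset.prod_ite_mem, Finset.prod_const, Finset.prod_const,
      Finset.inter_eq_right.2 hA, Finset.inter_eq_right.2 hB]
  rw [← hfg, Finset.prod_add]
  calc _ = ∑ E ∈ U.powerset with A ⊆ E ∧ Disjoint E B, (∏ e ∈ E, f e) * ∏ e ∈ U \ E, g e := by
        refine Finset.sum_congr rfl fun E hE => ?_
        obtain ⟨-, h1, h2⟩ := Finset.mem_filter.1 hE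
        congr 1
        · rw [← Finset.prod_const]
          refine Finset.prod_congr rfl fun e he => ?_
          simp [hf, Finset.disjoint_left.1 h2 he]
        · rw [← Finset.prod_const]
          refine Finset.prod_congr rfl fun e he => ?_
          have : e ∉ A := fun h => (Finset.mem_sdiff.1 he).2 (h1 h)
          simp [hg, this]
    _ ≤ _ := Finset.sum_le_sum_of_subset_of_nonneg (Finset.filter_subset _ _) fun E _ _ =>
        mul_nonneg (Finset.prod_nonneg fun e _ => hf0 e) (Finset.prod_nonneg fun e _ => hg0 e)

/-- The union bound. -/
theorem exists_forall_not_of_sum_lt {Ω ι : Type*} (S : Finset Ω) (I : Finset ι)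
    (P : Ω → ι → Prop) [∀ i, DecidablePred fun E => P E i] (w : Ω → ℝ) (b : ι → ℝ)
    (hw : ∀ E, 0 ≤ w E) (hb : ∀ i ∈ I, ∑ E ∈ S with P E i, w E ≤ b i)
    (hlt : ∑ i ∈ I, b i < ∑ E ∈ S, w E) : ∃ E ∈ S, ∀ i ∈ I, ¬ P E i := by
  by_contra! h
  refine absurd hlt (not_lt.2 ?_)
  calc ∑ E ∈ S, w E ≤ ∑ E ∈ S, ∑ i ∈ I, if P E i then w E else 0 := by
        refine Finset.sum_le_sum fun E hE => ?_
        obtain ⟨i, hi, hP⟩ := h E hE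
        refine le_trans ?_ (Finset.single_le_sum (f := fun i => if P E i then w E else 0)
          (fun j _ => ?_) hi)
        · simp [hP]
        · split_ifs
          exacts [hw E, le_rfl]
    _ = ∑ i ∈ I, ∑ E ∈ S, if P E i then w E else 0 := Finset.sum_comm
    _ = ∑ i ∈ I, ∑ E ∈ S with P E i, w E := by simp_rw [Finset.sum_filter]
    _ ≤ _ := Finset.sum_le_sum hb

/-- Deleting from a subset `E` of `U` a maximal disjoint family of members of `K` leaves no member
of `K`, and if what is left misses `t`, then `E ∩ t` is covered by a disjoint family of members of
`K` that meet `t`. -/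
theorem exists_deletion {α : Type*} [DecidableEq α] (K : Finset (Finset α))
    (hK : ∀ C ∈ K, C.Nonempty) (E : Finset α) :
    ∃ E' ⊆ E, (∀ C ∈ K, ¬ C ⊆ E') ∧ ∀ t, Disjoint E' t →
      ∃ F ⊆ K.filter fun C => ¬ Disjoint C t, (F : Set (Finset α)).PairwiseDisjoint id ∧
        F.biUnion id ⊆ E ∧ Disjoint E (t \ F.biUnion id) := by
  classical
  -- A largest disjoint family inside `E`; a member of `K` surviving the deletion could be added to
  -- it.
  obtain ⟨F, hF, hmax⟩ := Finset.exists_max_image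
    ((K.filter (· ⊆ E)).powerset.filter fun F : Finset (Finset α) =>
      (F : Set (Finset α)).PairwiseDisjoint id) Finset.card ⟨∅, by simp⟩
  rw [Finset.mem_filter, Finset.mem_powerset] at hF
  refine ⟨E \ F.biUnion id, Finset.sdiff_subset, fun C hC hCE => ?_, fun t ht => ?_⟩
  · have hdisj : ∀ D ∈ F, Disjoint C D := fun D hD =>
      Finset.disjoint_left.2 fun e he heD =>
        (Finset.mem_sdiff.1 (hCE he)).2 (Finset.mem_biUnion.2 ⟨D, hD, heD⟩)
    have hCF : C ∉ F := fun h => (hK C hC).ne_empty (disjoint_self.1 (hdisj C h))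
    have := hmax (insert C F) (Finset.mem_filter.2 ⟨?_, ?_⟩)
    · rw [Finset.card_insert_of_notMem hCF] at this
      omega
    · refine Finset.mem_powerset.2 (Finset.insert_subset ?_ hF.1)
      exact Finset.mem_filter.2 ⟨hC, hCE.trans Finset.sdiff_subset⟩
    · rw [Finset.coe_insert]
      exact hF.2.insert fun D hD _ => hdisj D hD
  · refine ⟨F.filter fun C => ¬ Disjoint C t, ?_, ?_, ?_, ?_⟩
    · exact Finset.filter_subset_filter _ (hF.1.trans (Finset.filter_subset _ _))
    · exact hF.2.subset fun C hC => (Finset.mem_filter.1 hC).1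
    · refine Finset.biUnion_subset.2 fun C hC => ?_
      exact (Finset.mem_filter.1 (hF.1 (Finset.mem_filter.1 hC).1)).2
    · refine Finset.disjoint_left.2 fun e he het => ?_
      obtain ⟨h1, h2⟩ := Finset.mem_sdiff.1 het
      refine Finset.disjoint_left.1 ht (Finset.mem_sdiff.2 ⟨he, fun h => h2 ?_⟩) h1
      obtain ⟨C, hC, heC⟩ := Finset.mem_biUnion.1 h
      refine Finset.mem_biUnion.2 ⟨C, Finset.mem_filter.2 ⟨hC, fun hd => ?_⟩, heC⟩
      exact Finset.disjoint_left.1 hd heC h1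

/-- If deletion from a random `E` destroys all of `E ∩ t`, some disjoint family `F` of members of
`K` meeting `t` lies in `E`, and `E` misses the rest of `t`. For fixed `(t, F)` this has probability
at most `x ^ |F| * (1 - p) ^ m` with `x = (p / (1 - p)) ^ Q`. Summing over all sets of at most `N`
members gives `(1 + x) ^ N`, so `hlt` is the union bound. -/
theorem exists_subset_free_of_lt_one {α : Type*} [DecidableEq α] (U : Finset α)
    (K T : Finset (Finset α)) {Q N m : ℕ} {p : ℝ} (hp0 : 0 < p) (hp1 : p < 1) (hQ : 1 ≤ Q)
    (hK : ∀ C ∈ K, C ⊆ U ∧ C.card = Q) (hT : ∀ t ∈ T, t ⊆ U ∧ m ≤ t.card)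
    (hN : ∀ t ∈ T, (K.filter fun C => ¬ Disjoint C t).card ≤ N)
    (hlt : T.card * ((1 + (p / (1 - p)) ^ Q) ^ N * (1 - p) ^ m) < 1) :
    ∃ E ⊆ U, (∀ C ∈ K, ¬ C ⊆ E) ∧ ∀ t ∈ T, ¬ Disjoint E t := by
  classical
  have hp1' : 0 < 1 - p := sub_pos.2 hp1
  set x : ℝ := (p / (1 - p)) ^ Q with hx
  have hx0 : 0 ≤ x := by positivity
  let I : Finset (Σ _ : Finset α, Finset (Finset α)) := T.sigma fun t =>
    (K.filter fun C => ¬ Disjoint C t).powerset.filter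
      fun F : Finset (Finset α) => (F : Set (Finset α)).PairwiseDisjoint id
  let P : Finset α → (Σ _ : Finset α, Finset (Finset α)) → Prop := fun E i =>
    i.2.biUnion id ⊆ E ∧ Disjoint E (i.1 \ i.2.biUnion id)
  have hb : ∀ i ∈ I, ∑ E ∈ U.powerset with P E i, p ^ E.card * (1 - p) ^ (U \ E).card ≤
      x ^ i.2.card * (1 - p) ^ m := by
    rintro ⟨t, F⟩ hi
    obtain ⟨ht, hi⟩ := Finset.mem_sigma.1 hi
    dsimp only at ht hi ⊢
    obtain ⟨hF, hd⟩ := Finset.mem_filter.1 hi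
    replace hF : ∀ C ∈ F, C ∈ K := fun C hC =>
      (Finset.mem_filter.1 (Finset.mem_powerset.1 hF hC)).1
    have hcard : (F.biUnion id).card = F.card * Q := by
      rw [Finset.card_biUnion hd]
      exact Finset.sum_const_nat fun C hC => (hK C (hF C hC)).2
    have hA : F.biUnion id ⊆ U := Finset.biUnion_subset.2 fun C hC => (hK C (hF C hC)).1
    refine (sum_filter_weight_le hA (Finset.sdiff_subset.trans (hT t ht).1) Finset.disjoint_sdiff hp0.le hp1.le).trans ?_
    have h1 : p ^ (F.biUnion id).card = x ^ F.card * (1 - p) ^ (F.biUnion id).card := by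
      rw [hcard, hx, ← pow_mul, mul_comm Q, div_pow, div_mul_cancel₀]
      positivity
    rw [h1, mul_assoc, ← pow_add]
    refine mul_le_mul_of_nonneg_left (pow_le_pow_of_le_one hp1'.le (by linarith) ?_) (by positivity)
    have := Finset.le_card_sdiff (F.biUnion id) t
    have := (hT t ht).2
    omega
  have hsum : ∑ i ∈ I, x ^ i.2.card * (1 - p) ^ m <
      ∑ E ∈ U.powerset, p ^ E.card * (1 - p) ^ (U \ E).card := by
    have h1 : ∑ E ∈ U.powerset, p ^ E.card * (1 - p) ^ (U \ E).card = 1 := by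
      have := Finset.prod_add (fun _ => p) (fun _ => 1 - p) U
      simp only [Finset.prod_const] at this
      rw [← this]
      simp
    rw [h1, Finset.sum_sigma]
    refine lt_of_le_of_lt ?_ hlt
    rw [← nsmul_eq_mul]
    refine Finset.sum_le_card_nsmul _ _ _ fun t ht => ?_
    refine (Finset.sum_le_sum_of_subset_of_nonneg (Finset.filter_subset _ _)
      fun F _ _ => by positivity).trans ?_
    rw [← Finset.sum_mul]
    refine mul_le_mul_of_nonneg_right ?_ (by positivity)
    have := Finset.sum_pow_mul_eq_add_pow x 1 (K.filter fun C => ¬ Disjoint C t)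
    simp only [one_pow, mul_one] at this
    rw [this, add_comm]
    exact pow_le_pow_right₀ (by linarith) (hN t ht)
  obtain ⟨E, hE, hEI⟩ := exists_forall_not_of_sum_lt U.powerset I P
    (fun E => p ^ E.card * (1 - p) ^ (U \ E).card) (fun i => x ^ i.2.card * (1 - p) ^ m)
    (fun E => by positivity) hb hsum
  obtain ⟨E', hE', h1, h2⟩ := exists_deletion K
    (fun C hC => Finset.card_pos.1 (by rw [(hK C hC).2]; omega)) E
  refine ⟨E', hE'.trans (Finset.mem_powerset.1 hE), h1, fun t ht hd => ?_⟩
  obtain ⟨F, hF, hF1, hF2⟩ := h2 t hd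
  exact hEI ⟨t, F⟩ (Finset.mem_sigma.2 ⟨ht, Finset.mem_filter.2
    ⟨Finset.mem_powerset.2 hF, hF1⟩⟩) hF2

/-! ### A lower bound for Ramsey numbers -/

/-- The set of unordered pairs of distinct elements of `S`. -/
def Finset.pairs {V : Type*} [DecidableEq V] (S : Finset V) : Finset (Sym2 V) :=
  S.offDiag.image Sym2.mk.uncurry

theorem Finset.mk_mem_pairs {V : Type*} [DecidableEq V] {S : Finset V} {a b : V} :
    s(a, b) ∈ S.pairs ↔ a ∈ S ∧ b ∈ S ∧ a ≠ b := by
  simp only [Finset.pairs, Finset.mem_image, Finset.mem_offDiag, Prod.exists,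
    Function.uncurry_apply_pair, Sym2.eq_iff]
  constructor
  · rintro ⟨x, y, ⟨hx, hy, hxy⟩, ⟨rfl, rfl⟩ | ⟨rfl, rfl⟩⟩
    exacts [⟨hx, hy, hxy⟩, ⟨hy, hx, hxy.symm⟩]
  · exact fun h => ⟨a, b, h, Or.inl ⟨rfl, rfl⟩⟩

theorem Finset.card_pairs {V : Type*} [DecidableEq V] (S : Finset V) :
    S.pairs.card = S.card.choose 2 :=
  Sym2.card_image_offDiag S

/-- The number of `q`-sets that share a pair with `t` is at most `|t| ^ 2 * n ^ (q - 2)`. -/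
theorem card_filter_not_disjoint_pairs_le {V : Type*} [Fintype V] [DecidableEq V] {q : ℕ}
    (hq : 2 ≤ q) (t : Finset V) :
    (((Finset.powersetCard q (Finset.univ : Finset V)).image Finset.pairs).filter
      fun C => ¬ Disjoint C t.pairs).card ≤ t.card ^ 2 * Fintype.card V ^ (q - 2) := by
  have hsub : (((Finset.powersetCard q (Finset.univ : Finset V)).image Finset.pairs).filter
      fun C => ¬ Disjoint C t.pairs) ⊆
      ((t ×ˢ t) ×ˢ Finset.powersetCard (q - 2) (Finset.univ : Finset V)).image
        fun x => (insert x.1.1 (insert x.1.2 x.2)).pairs := by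
    intro C hC
    obtain ⟨hC, hd⟩ := Finset.mem_filter.1 hC
    obtain ⟨S, hS, rfl⟩ := Finset.mem_image.1 hC
    obtain ⟨e, he, het⟩ := Finset.not_disjoint_iff.1 hd
    induction e with
    | h a b =>
      obtain ⟨ha, hb, hab⟩ := Finset.mk_mem_pairs.1 he
      obtain ⟨hat, hbt, -⟩ := Finset.mk_mem_pairs.1 het
      have hb' : b ∈ S.erase a := Finset.mem_erase.2 ⟨hab.symm, hb⟩
      refine Finset.mem_image.2 ⟨((a, b), (S.erase a).erase b), ?_, ?_⟩
      · refine Finset.mem_product.2 ⟨Finset.mem_product.2 ⟨hat, hbt⟩, ?_⟩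
        rw [Finset.mem_powersetCard]
        refine ⟨Finset.subset_univ _, ?_⟩
        rw [Finset.card_erase_of_mem hb', Finset.card_erase_of_mem ha,
          (Finset.mem_powersetCard.1 hS).2]
        omega
      · simp only [Finset.insert_erase hb', Finset.insert_erase ha]
  refine (Finset.card_le_card hsub).trans (Finset.card_image_le.trans ?_)
  rw [Finset.card_product, Finset.card_product, ← sq, Finset.card_powersetCard, Finset.card_univ]
  exact Nat.mul_le_mul_left _ (Nat.choose_le_pow _ _)

/-- Here the random set consists of edges, and `K` and `T` are the pair sets of `q`-sets and
`k`-sets. Loops in the ground set `Sym2 (Fin n)` are harmless: `fromEdgeSet` discards them. -/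
theorem exists_cliqueFree_indepSetFree {n q k : ℕ} {p : ℝ} (hq : 2 ≤ q) (hp0 : 0 < p)
    (hp1 : p < 1)
    (hlt : (n : ℝ) ^ k * ((1 + (p / (1 - p)) ^ q.choose 2) ^ (k ^ 2 * n ^ (q - 2)) *
      (1 - p) ^ k.choose 2) < 1) :
    ∃ H : SimpleGraph (Fin n), H.CliqueFree q ∧ H.IndepSetFree k := by
  classical
  have hp1' : 0 < 1 - p := sub_pos.2 hp1
  have hpairs : ∀ r, ∀ C ∈ (Finset.powersetCard r (Finset.univ : Finset (Fin n))).image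
      Finset.pairs, C.card = r.choose 2 := by
    intro r C hC
    obtain ⟨S, hS, rfl⟩ := Finset.mem_image.1 hC
    rw [Finset.card_pairs, (Finset.mem_powersetCard.1 hS).2]
  have hmeet : ∀ t ∈ (Finset.powersetCard k (Finset.univ : Finset (Fin n))).image Finset.pairs,
      (((Finset.powersetCard q (Finset.univ : Finset (Fin n))).image Finset.pairs).filter
        fun C => ¬ Disjoint C t).card ≤ k ^ 2 * n ^ (q - 2) := by
    intro C hC
    obtain ⟨S, hS, rfl⟩ := Finset.mem_image.1 hC
    have := card_filter_not_disjoint_pairs_le hq S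
    rwa [(Finset.mem_powersetCard.1 hS).2, Fintype.card_fin] at this
  have h1 : ((Finset.powersetCard k (Finset.univ : Finset (Fin n))).image
      Finset.pairs).card ≤ n ^ k := by
    refine Finset.card_image_le.trans ?_
    rw [Finset.card_powersetCard, Finset.card_univ, Fintype.card_fin]
    exact Nat.choose_le_pow _ _
  obtain ⟨E, -, hE1, hE2⟩ := exists_subset_free_of_lt_one (Finset.univ : Finset (Sym2 (Fin n)))
    ((Finset.powersetCard q Finset.univ).image Finset.pairs)
    ((Finset.powersetCard k Finset.univ).image Finset.pairs) (Q := q.choose 2)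
    (N := k ^ 2 * n ^ (q - 2)) (m := k.choose 2) hp0 hp1 (Nat.choose_pos hq)
    (fun C hC => ⟨Finset.subset_univ _, hpairs q C hC⟩)
    (fun C hC => ⟨Finset.subset_univ _, (hpairs k C hC).ge⟩) hmeet
    (lt_of_le_of_lt (mul_le_mul_of_nonneg_right (by exact_mod_cast h1) (by positivity)) hlt)
  have hadj : ∀ a b, (SimpleGraph.fromEdgeSet (E : Set (Sym2 (Fin n)))).Adj a b ↔
      s(a, b) ∈ E ∧ a ≠ b := fun a b => by simp
  refine ⟨SimpleGraph.fromEdgeSet (E : Set (Sym2 (Fin n))), fun s hs => ?_, fun s hs => ?_⟩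
  · refine hE1 s.pairs (Finset.mem_image_of_mem _ (Finset.mem_powersetCard.2
      ⟨Finset.subset_univ _, hs.card_eq⟩)) fun e he => ?_
    induction e with
    | h a b =>
      obtain ⟨ha, hb, hab⟩ := Finset.mk_mem_pairs.1 he
      exact ((hadj a b).1 (hs.isClique ha hb hab)).1
  · refine hE2 s.pairs (Finset.mem_image_of_mem _ (Finset.mem_powersetCard.2
      ⟨Finset.subset_univ _, hs.card_eq⟩)) (Finset.disjoint_left.2 fun e he hes => ?_)
    induction e with
    | h a b =>
      obtain ⟨ha, hb, hab⟩ := Finset.mk_mem_pairs.1 hes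
      exact hs.isIndepSet ha hb hab ((hadj a b).2 ⟨he, hab⟩)

theorem exists_cliqueFree_indepSetFree_of_log_lt {n q k : ℕ} {p : ℝ} (hq : 2 ≤ q) (hn : 0 < n)
    (hk : 2 ≤ k) (hp0 : 0 < p) (hp1 : p ≤ 1 / 2)
    (hlt : Real.log n + k * ((n : ℝ) ^ (q - 2) * (2 * p) ^ q.choose 2) < p * k / 4) :
    ∃ H : SimpleGraph (Fin n), H.CliqueFree q ∧ H.IndepSetFree k := by
  refine exists_cliqueFree_indepSetFree hq hp0 (by linarith) ?_
  have hp1' : 0 < 1 - p := by linarith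
  have hn' : (0 : ℝ) < n := by exact_mod_cast hn
  have hk' : (2 : ℝ) ≤ k := by exact_mod_cast hk
  have hx : (p / (1 - p)) ^ q.choose 2 ≤ (2 * p) ^ q.choose 2 := by
    refine pow_le_pow_left₀ (by positivity) ?_ _
    rw [div_le_iff₀ hp1']
    nlinarith
  set x := (p / (1 - p)) ^ q.choose 2
  set y := (2 * p) ^ q.choose 2
  have hx0 : 0 ≤ x := by positivity
  have h1 : (n : ℝ) ^ k = Real.exp (k * Real.log n) := by
    rw [Real.exp_nat_mul, Real.exp_log hn']
  have h2 : (1 + x) ^ (k ^ 2 * n ^ (q - 2)) ≤ Real.exp ((k ^ 2 * n ^ (q - 2) : ℕ) * y) := by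
    rw [Real.exp_nat_mul]
    refine pow_le_pow_left₀ (by positivity) ?_ _
    linarith [Real.add_one_le_exp y]
  have h3 : (1 - p) ^ k.choose 2 ≤ Real.exp ((k.choose 2 : ℕ) * (-p)) := by
    rw [Real.exp_nat_mul]
    refine pow_le_pow_left₀ hp1'.le ?_ _
    linarith [Real.add_one_le_exp (-p)]
  calc _ ≤ Real.exp (k * Real.log n) * (Real.exp ((k ^ 2 * n ^ (q - 2) : ℕ) * y) *
        Real.exp ((k.choose 2 : ℕ) * (-p))) := by
        rw [h1]
        gcongr
    _ < 1 := by
        rw [← Real.exp_add, ← Real.exp_add, Real.exp_lt_one_iff, Nat.cast_choose_two]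
        push_cast
        have h4 := mul_lt_mul_of_pos_left hlt (show (0 : ℝ) < k by linarith)
        -- This encodes `k.choose 2 ≥ k ^ 2 / 4`, the source of the `4` in `hlt`.
        have h5 : 0 ≤ p * (k * (k - 2)) := by
          have : 0 ≤ (k : ℝ) - 2 := by linarith
          positivity
        nlinarith

open Filter in
theorem eventually_exists_cliqueFree_indepSetFree {q : ℕ} (hq : 3 ≤ q) {η : ℝ} (hη : 0 < η)
    (hη1 : η ≤ 1) :
    ∀ᶠ k : ℕ in atTop, ∃ H : SimpleGraph (Fin ⌈(k : ℝ) ^ (((q : ℝ) + 1) / 2 - η)⌉₊),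
      H.CliqueFree q ∧ H.IndepSetFree k := by
  obtain ⟨r, rfl⟩ : ∃ r, q = r + 2 := ⟨q - 2, by omega⟩
  have hr : (1 : ℝ) ≤ r := by exact_mod_cast (by omega : 1 ≤ r)
  set s : ℝ := ((r + 2 : ℕ) + 1) / 2 - η with hs
  have hs0 : 0 < s := by rw [hs]; push_cast; linarith
  set Q := (r + 2).choose 2 with hQ
  have hQr : (Q : ℝ) = 1 + r * (r + 3) / 2 := by
    rw [hQ, Nat.cast_choose_two]; push_cast; ring
  -- With `p = k ^ (-(1 - τ))` and `n ≈ k ^ s`, the clique term `k * n ^ r * p ^ Q` has exponent `1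
  -- + r s - (1 - τ) Q = τ - r η / 2`. This choice of `τ` lets the slack `r η` in `r s` pay for `τ Q
  -- = τ + r η / 2`, leaving `e = r η / 2` to spare.
  set τ : ℝ := η / (r + 3) with hτ
  have hτ0 : 0 < τ := by positivity
  have hτη : τ * (r + 3) = η := by rw [hτ]; field_simp
  have hτ1 : τ < 1 := by nlinarith
  set e : ℝ := r * (η / 2) with he
  have he0 : 0 < e := by positivity
  have hcast := tendsto_natCast_atTop_atTop (R := ℝ)
  -- These make `p ≤ 1 / 2` and bound the clique term and `log n` by `k ^ τ / 16` each, against the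
  -- target `p * k / 4 = k ^ τ / 4`.
  have t1 : ∀ᶠ k : ℕ in atTop, (k : ℝ) ^ (-(1 - τ)) < 1 / 2 :=
    ((tendsto_rpow_neg_atTop (sub_pos.2 hτ1)).comp hcast).eventually_lt_const (by norm_num)
  have t2 : ∀ᶠ k : ℕ in atTop, (k : ℝ) ^ (-e) < 1 / (16 * (2 ^ r * 2 ^ Q)) :=
    ((tendsto_rpow_neg_atTop he0).comp hcast).eventually_lt_const (by positivity)
  have t3 : ∀ᶠ k : ℕ in atTop, |Real.log (k : ℝ)| ≤ 1 / (16 * (1 + s)) * |(k : ℝ) ^ τ| :=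
    hcast.eventually ((isLittleO_log_rpow_atTop hτ0).bound (by positivity))
  filter_upwards [t1, t2, t3, eventually_ge_atTop 2] with k h1 h2 h3 hk
  have hk' : (2 : ℝ) ≤ k := by exact_mod_cast hk
  have hk0 : (0 : ℝ) < k := by linarith
  have hks : 1 ≤ (k : ℝ) ^ s := Real.one_le_rpow (by linarith) hs0.le
  have hn0 : 0 < ⌈(k : ℝ) ^ s⌉₊ := Nat.ceil_pos.2 (by linarith)
  have hn : (⌈(k : ℝ) ^ s⌉₊ : ℝ) ≤ 2 * (k : ℝ) ^ s := by
    linarith [Nat.ceil_lt_add_one (show 0 ≤ (k : ℝ) ^ s by linarith)]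
  set n := ⌈(k : ℝ) ^ s⌉₊
  have hn' : (0 : ℝ) < n := by exact_mod_cast hn0
  have hlogk : Real.log 2 ≤ Real.log k := Real.log_le_log (by norm_num) hk'
  have hkτ : 0 < (k : ℝ) ^ τ := by positivity
  refine exists_cliqueFree_indepSetFree_of_log_lt (p := (k : ℝ) ^ (-(1 - τ))) (by omega) hn0 hk
    (by positivity) h1.le ?_
  have hpk : (k : ℝ) ^ (-(1 - τ)) * k = (k : ℝ) ^ τ := by
    rw [← Real.rpow_add_one hk0.ne']; congr 1; ring
  have hlog : Real.log n ≤ (k : ℝ) ^ τ / 16 := by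
    have : Real.log n ≤ Real.log 2 + s * Real.log k := by
      rw [← Real.log_rpow hk0, ← Real.log_mul (by norm_num) (by positivity)]
      exact Real.log_le_log hn' hn
    rw [abs_of_pos hkτ] at h3
    have h4 := (le_abs_self _).trans h3
    have h5 := mul_le_mul_of_nonneg_left h4 (show 0 ≤ 1 + s by linarith)
    have h6 : (1 + s) * (1 / (16 * (1 + s)) * (k : ℝ) ^ τ) = (k : ℝ) ^ τ / 16 := by
      field_simp
    linarith
  have hcl : k * ((n : ℝ) ^ (r + 2 - 2) * (2 * (k : ℝ) ^ (-(1 - τ))) ^ Q) ≤ (k : ℝ) ^ τ / 16 := by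
    rw [Nat.add_sub_cancel]
    calc _ ≤ k * ((2 * (k : ℝ) ^ s) ^ r * (2 * (k : ℝ) ^ (-(1 - τ))) ^ Q) := by gcongr
      _ = 2 ^ r * 2 ^ Q * ((k : ℝ) ^ τ * (k : ℝ) ^ (-e)) := by
        have : (k : ℝ) ^ τ * (k : ℝ) ^ (-e) =
            k * (((k : ℝ) ^ s) ^ r * ((k : ℝ) ^ (-(1 - τ))) ^ Q) := by
          rw [← Real.rpow_mul_natCast hk0.le, ← Real.rpow_mul_natCast hk0.le,
            ← Real.rpow_add hk0, ← Real.rpow_add hk0, mul_comm (k : ℝ),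
            ← Real.rpow_add_one hk0.ne']
          congr 1
          rw [hQr, he, hs, ← hτη]
          push_cast
          ring
        rw [this]
        ring
      _ ≤ 2 ^ r * 2 ^ Q * ((k : ℝ) ^ τ * (1 / (16 * (2 ^ r * 2 ^ Q)))) := by gcongr
      _ = _ := by field_simp
  rw [hpk]
  linarith

/-! ### Binding functions -/

open Filter in
theorem not_isTwOmegaBinding_rpow {q : ℕ} (hq : 3 ≤ q) {c ε : ℝ} (hc : 0 < c) (hε : 0 < ε) :
    ¬ (boundedIndepClass q).IsTwOmegaBinding
      fun k => c * (k : ℝ) ^ (((q : ℝ) + 1) / 2 - ε) := by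
  intro hbind
  have hq' : (3 : ℝ) ≤ q := by exact_mod_cast hq
  -- Capping `ε` keeps the exponent `(q + 1) / 2 - δ` nonnegative, so that `ω ≤ k` can be used
  -- monotonically.
  set δ := min ε 1 with hδ
  have hδ0 : 0 < δ := lt_min hε one_pos
  have hδ1 : δ ≤ 1 := min_le_right _ _
  have hδε : δ ≤ ε := min_le_left _ _
  have t1 : ∀ᶠ k : ℕ in atTop, (q : ℝ) * (c + 1) < (k : ℝ) ^ (δ / 2) :=
    ((tendsto_rpow_atTop (half_pos hδ0)).comp
      (tendsto_natCast_atTop_atTop (R := ℝ))).eventually_gt_atTop _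
  obtain ⟨k, hH, hk, hk1⟩ :=
    ((eventually_exists_cliqueFree_indepSetFree hq (half_pos hδ0) (by linarith)).and
      (t1.and (eventually_ge_atTop 1))).exists
  have hk1' : (1 : ℝ) ≤ k := by exact_mod_cast hk1
  have hk0 : (0 : ℝ) < k := by linarith
  obtain ⟨n, hn⟩ : ∃ n, n = ⌈(k : ℝ) ^ (((q : ℝ) + 1) / 2 - δ / 2)⌉₊ := ⟨_, rfl⟩
  have hn0 : 0 < n := hn ▸ Nat.ceil_pos.2 (by positivity)
  rw [← hn] at hH
  obtain ⟨H, hH1, hH2⟩ := hH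
  have hα : (Hᶜ).indepNum < q := by
    rw [SimpleGraph.indepNum_compl]
    by_contra! h
    obtain ⟨s, hs⟩ := H.exists_isNClique_cliqueNum
    exact hH1.mono h s hs
  have hω : (Hᶜ).cliqueNum ≤ k := by
    rw [SimpleGraph.cliqueNum_compl]
    by_contra! h
    obtain ⟨s, hs⟩ := H.exists_isNIndepSet_indepNum
    exact ((SimpleGraph.cliqueFree_compl H).2 hH2).mono h.le s ((SimpleGraph.isNClique_compl H).2 hs)
  have htw := hbind (Fin n) Hᶜ hα Set.univ
  set G := (Hᶜ).induce Set.univ with hG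
  have hω1 : 1 ≤ G.cliqueNum := by
    have : G.IsClique (({⟨⟨0, hn0⟩, trivial⟩} : Finset (Set.univ : Set (Fin n))) :
      Set (Set.univ : Set (Fin n))) := by simp
    simpa using this.card_le_cliqueNum
  have hω1' : (1 : ℝ) ≤ G.cliqueNum := by exact_mod_cast hω1
  have hωk : (G.cliqueNum : ℝ) ≤ k := by
    exact_mod_cast (SimpleGraph.cliqueNum_induce_le (G := Hᶜ) Set.univ).trans hω
  have hcard : n ≤ q * (treewidth G + 1) := by
    have h1 := card_le_indepNum_mul_treewidth_add_one G
    have h2 := (indepNum_induce_le Hᶜ Set.univ).trans hα.le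
    simp only [Fintype.card_setUniv, Fintype.card_fin] at h1
    exact h1.trans (Nat.mul_le_mul_right _ h2)
  have hcard' : (n : ℝ) ≤ q * (treewidth G + 1) := by exact_mod_cast hcard
  set s := ((q : ℝ) + 1) / 2 - δ with hs
  have hs0 : 0 ≤ s := by linarith
  have h3 : (G.cliqueNum : ℝ) ^ (((q : ℝ) + 1) / 2 - ε) ≤ (k : ℝ) ^ s :=
    (Real.rpow_le_rpow_of_exponent_le hω1' (by linarith)).trans
      (Real.rpow_le_rpow (by linarith) hωk hs0)
  have h4 : (treewidth G : ℝ) ≤ c * (k : ℝ) ^ s :=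
    htw.trans (mul_le_mul_of_nonneg_left h3 hc.le)
  have h5 : 1 ≤ (k : ℝ) ^ s := Real.one_le_rpow hk1' hs0
  have h6 : (k : ℝ) ^ (δ / 2) * (k : ℝ) ^ s ≤ n := by
    rw [← Real.rpow_add hk0, show δ / 2 + s = ((q : ℝ) + 1) / 2 - δ / 2 by rw [hs]; ring]
    exact hn ▸ Nat.le_ceil _
  -- Now `k ^ (δ / 2) * k ^ s ≤ n ≤ q (c + 1) k ^ s`, where `1 ≤ k ^ s` absorbs the `+ 1`; this
  -- contradicts the choice of `k`.
  have h7 : (q : ℝ) * (treewidth G + 1) ≤ q * ((c + 1) * (k : ℝ) ^ s) :=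
    mul_le_mul_of_nonneg_left (by linarith) (by linarith)
  have h8 := mul_lt_mul_of_pos_right hk (show 0 < (k : ℝ) ^ s by linarith)
  linarith

theorem exists_eval_natCast_le (p : ℝ[X]) :
    ∃ C : ℝ, 0 < C ∧ ∀ k : ℕ, 1 ≤ k → p.eval (k : ℝ) ≤ C * (k : ℝ) ^ p.natDegree := by
  refine ⟨1 + ∑ i ∈ Finset.range (p.natDegree + 1), |p.coeff i|, by positivity, fun k hk => ?_⟩
  have hk' : (1 : ℝ) ≤ k := by exact_mod_cast hk
  rw [Polynomial.eval_eq_sum_range, add_mul, one_mul, Finset.sum_mul]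
  have : ∑ i ∈ Finset.range (p.natDegree + 1), p.coeff i * (k : ℝ) ^ i ≤
      ∑ i ∈ Finset.range (p.natDegree + 1), |p.coeff i| * (k : ℝ) ^ p.natDegree := by
    refine Finset.sum_le_sum fun i hi => ?_
    have := Finset.mem_range_succ_iff.1 hi
    exact mul_le_mul (le_abs_self _) (pow_le_pow_right₀ hk' this) (by positivity) (abs_nonneg _)
  have h0 : 0 ≤ (k : ℝ) ^ p.natDegree := by positivity
  linarith

theorem isPolynomiallyTwOmegaBounded_boundedIndepClass {q : ℕ} (hq : 1 ≤ q) :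
    (boundedIndepClass q).IsPolynomiallyTwOmegaBounded :=
  ⟨fun k => (k + (q - 1)).choose (q - 1), choosePolynomial (q - 1),
    fun k => (eval_choosePolynomial (q - 1) k).symm, isTwOmegaBinding_choose hq⟩

theorem not_exists_polynomial_isTwOmegaBinding :
    ¬ ∃ p : ℝ[X], ∀ 𝒢 : GraphClass, 𝒢.IsPolynomiallyTwOmegaBounded →
        𝒢.IsTwOmegaBinding fun k => p.eval (k : ℝ) := by
  rintro ⟨p, hp⟩
  obtain ⟨C, hC, hpC⟩ := exists_eval_natCast_le p
  -- For `q = 2 d + 3` and `ε = 2` the excluded exponent `(q + 1) / 2 - ε` is exactly `d`, the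
  -- degree of `p`.
  have hq : 3 ≤ 2 * p.natDegree + 3 := by omega
  refine not_isTwOmegaBinding_rpow hq hC two_pos ?_
  have hs : (((2 * p.natDegree + 3 : ℕ) : ℝ) + 1) / 2 - 2 = p.natDegree := by push_cast; ring
  intro V _ G hG s
  have h := hp _ (isPolynomiallyTwOmegaBounded_boundedIndepClass (by omega)) V G hG s
  rw [hs]
  simp only [Real.rpow_natCast]
  -- The bound on `p` needs `ω ≥ 1`; clique number `0` means no vertices, hence treewidth `0`.
  rcases Nat.eq_zero_or_pos (G.induce s).cliqueNum with h0 | h0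
  · have := Fintype.ofFinite s
    have hs0 : Fintype.card s = 0 := by
      by_contra hne
      obtain ⟨v⟩ := Fintype.card_pos_iff.1 (Nat.pos_of_ne_zero hne)
      have hv : (G.induce s).IsClique (({v} : Finset s) : Set s) := by simp
      have := hv.card_le_cliqueNum
      rw [h0, Finset.card_singleton] at this
      omega
    have htw : treewidth (G.induce s) = 0 := by
      have := treewidth_le_card_sub_one (G.induce s)
      omega
    rw [htw]
    simp only [Nat.cast_zero]
    positivity
  · exact h.trans (hpC _ h0)

theorem mainTheorem12 :
    (∀ q : ℕ, 3 ≤ q →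
      (boundedIndepClass q).IsTwOmegaBounded ∧
      (∃ (f : ℕ → ℕ) (p : ℝ[X]), p.natDegree = q - 1 ∧
        (∀ k : ℕ, (f k : ℝ) = p.eval (k : ℝ)) ∧
        (boundedIndepClass q).IsTwOmegaBinding fun k => (f k : ℝ)) ∧
      (∀ c : ℝ, 0 < c → ∀ ε : ℝ, 0 < ε →
        ¬ (boundedIndepClass q).IsTwOmegaBinding
            fun k => c * (k : ℝ) ^ (((q : ℝ) + 1) / 2 - ε))) ∧
    ¬ ∃ p : ℝ[X], ∀ 𝒢 : GraphClass, 𝒢.IsPolynomiallyTwOmegaBounded →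
        𝒢.IsTwOmegaBinding fun k => p.eval (k : ℝ) := by
  refine ⟨fun q hq => ?_, not_exists_polynomial_isTwOmegaBinding⟩
  have hbind := isTwOmegaBinding_choose (show 1 ≤ q by omega)
  exact ⟨⟨_, hbind⟩,
    ⟨_, choosePolynomial (q - 1), natDegree_choosePolynomial _,
      fun k => (eval_choosePolynomial (q - 1) k).symm, hbind⟩,
    fun c hc ε hε => not_isTwOmegaBinding_rpow hq hc hε⟩
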